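/- **Setting.** An instance of MPMD or MBPMD consists of $2m$ requests $u$ in a metric space, each with a position $\mathrm{pos}(u)$, an arrival time $\mathrm{atime}(u)\ge 0$ (requests are listed in order of arrival) and a polarity $\mathrm{sgn}(u)$. In MPMD all polarities are $0$; in MBPMD $m$ requests have polarity $+1$ and $m$ have $-1$. Two different requests $u,v$ form an edge (may be matched) if $\mathrm{sgn}(u)=-\mathrm{sgn}(v)$. Matching $u,v$ at a time $\tau\ge\max(\mathrm{atime}(u),\mathrm{atime}(v))$ costs $\mathrm{dist}(\mathrm{pos}(u),\mathrm{pos}(v))+(\tau-\mathrm{atime}(u))+(\tau-\mathrm{atime}(v))$. A solution matches every request exactly once; $\mathrm{OPT}(I)$ is the optimal offline cost. **Greedy Dual (GD)** starts at time $0$. It maintains a partition of the arrived requests into active sets, and dual variables $y_S\ge 0$ for sets $S$ of requests, initially $0$. When $u$ arrives, $\{u\}$ becomes an active set. An active set is *growing* if it contains an unmatched (free) request. As long as no event occurs, $y_S$ increases at unit rate for every growing active set $S$. Whenever there is an edge $(u,v)$ between two different active sets that is tight, i.e. $\sum_{S:\,|S\cap\{u,v\}|=1}y_S=\mathrm{dist}(\mathrm{pos}(u),\mathrm{pos}(v))+|\mathrm{atime}(u)-\mathrm{atime}(v)|$,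 these two active sets are replaced by their union, and then free requests in the union that form edges are matched with each other until no such pair is left. Ties are broken arbitrarily; $\mathrm{GD}(I)$ denotes the total cost of the produced matching. **Theorem (tightness of the analysis).** For MPMD and MBPMD alike, GD has cost $\Omega(m)\cdot\mathrm{OPT}$ on suitable instances with $2m$ requests on a two-point metric space. More precisely, let $p,q$ be two points at distance $2$ and, for a positive integer $m$, put $\varepsilon=1/m$. Let $I_m$ be the instance with one request at $p$ and one at $q$ (in this order) at each of the $m$ times $0,\ 1+\varepsilon,\ 1+3\varepsilon,\ \dots,\ 1+(2m-3)\varepsilon$; for MBPMD the odd-numbered requests at $p$ are positive, the even-numbered ones are negative, and the polarities at $q$ are opposite to those at $p$. There is an absolute constant $c>0$ such that for both variants and every $m\ge 1$: 1. $I_m$ is a valid instance of the variant and $\mathrm{OPT}(I_m)>0$. 2. GD has a run on $I_m$ that matches all requests, and every such run, for every way of breaking ties, produces a feasible solution. It matches the two requests of each pair with each other, across distance $2$, the $k$-th pair ($k=1,\dots,m$) at time $1+2(k-1)\varepsilon$. That is, the first pair is matched at time $1$, and every later pair arrives exactly $\varepsilon$ after the previous pair is matched and is matched $\varepsilon$ after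 its arrival. Its total connection cost is $2m$, and its cost satisfies $\mathrm{GD}(I_m)\ge c\,m\,\mathrm{OPT}(I_m)$. 3. If $m$ is even, the solution that matches, at each of the two points separately, the requests $1$ and $2$, $3$ and $4$, and so on, each pair as soon as both have arrived, is feasible and has cost $2\,(1+(m-1)\varepsilon)<4$. -/

import Mathlib

open Finset

/-- The two variants of the problem: non-bipartite (MPMD) and bipartite (MBPMD). -/
inductive Variant
  | mpmd
  | mbpmd

/-- An input: `2m` requests with positions in a metric space, arrival times
(in order of arrival) and polarities. -/
structure Instance (X : Type*) [MetricSpace X] (m : ℕ) where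
  pos : Fin (2 * m) → X
  atime : Fin (2 * m) → ℝ
  sgn : Fin (2 * m) → ℤ
  atime_nonneg : ∀ u, 0 ≤ atime u
  atime_mono : Monotone atime

/-- A matching edge: two requests and the time at which they are matched. -/
structure MatchEdge (m : ℕ) where
  fst : Fin (2 * m)
  snd : Fin (2 * m)
  time : ℝ

/-- The requests covered by a list of matching edges (with repetitions). -/
def endpoints {m : ℕ} (M : List (MatchEdge m)) : List (Fin (2 * m)) :=
  M.flatMap fun e => [e.fst, e.snd]

/-- The requests of `S` that are not matched by `M`. -/
def freeRequests {m : ℕ} (M : List (MatchEdge m)) (S : Finset (Fin (2 * m))) :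
    Finset (Fin (2 * m)) :=
  S.filter fun u => u ∉ endpoints M

/-- A state of Greedy Dual: the current time, the number of requests that have arrived (requests
arrive in the order of their indices), the mapping that assigns to each arrived request its active
set (its values at other requests are irrelevant), the dual variables, and the matching edges
created so far. -/
structure GDState (m : ℕ) where
  time : ℝ
  arrived : ℕ
  active : Fin (2 * m) → Finset (Fin (2 * m))
  y : Finset (Fin (2 * m)) → ℝ
  matching : List (MatchEdge m)

namespace GDState

variable {m : ℕ}

/-- The state at time `0`, before any request has arrived. -/
def initial (m : ℕ) : GDState m where
  time := 0
  arrived := 0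
  active := fun _ => ∅
  y := fun _ => 0
  matching := []

def HasArrived (s : GDState m) (u : Fin (2 * m)) : Prop := u.val < s.arrived

/-- The active sets that contain a free request. -/
def growingSets (s : GDState m) : Finset (Finset (Fin (2 * m))) :=
  ((univ.filter fun u : Fin (2 * m) => u.val < s.arrived).image s.active).filter
    fun S => (freeRequests s.matching S).Nonempty

/-- The dual variables after the variables of all growing active sets are increased by `δ`. -/
def grownY (s : GDState m) (δ : ℝ) (S : Finset (Fin (2 * m))) : ℝ :=
  if S ∈ s.growingSets then s.y S + δ else s.y S

end GDState

namespace Instance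

variable {X : Type*} [MetricSpace X] {m : ℕ}

/-- Polarities are all `0` in MPMD; in MBPMD they are `±1`, with equally many of each sign. -/
def IsOf (I : Instance X m) : Variant → Prop
  | .mpmd => ∀ u, I.sgn u = 0
  | .mbpmd => (∀ u, I.sgn u = 1 ∨ I.sgn u = -1) ∧
      (univ.filter fun u => I.sgn u = 1).card = (univ.filter fun u => I.sgn u = -1).card

/-- `u` and `v` are different requests that may be matched with each other. -/
def IsEdge (I : Instance X m) (u v : Fin (2 * m)) : Prop :=
  u ≠ v ∧ I.sgn u = -I.sgn v

/-- Connection cost plus the two waiting costs. -/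
def edgeCost (I : Instance X m) (e : MatchEdge m) : ℝ :=
  dist (I.pos e.fst) (I.pos e.snd) + (e.time - I.atime e.fst) + (e.time - I.atime e.snd)

def cost (I : Instance X m) (M : List (MatchEdge m)) : ℝ := (M.map I.edgeCost).sum

def connectionCost (I : Instance X m) (M : List (MatchEdge m)) : ℝ :=
  (M.map fun e => dist (I.pos e.fst) (I.pos e.snd)).sum

/-- `M` is a solution: every request is in exactly one matching edge, and every matching edge joins
two compatible requests at a time when both have arrived. -/
structure IsFeasible (I : Instance X m) (M : List (MatchEdge m)) : Prop where
  nodup : (endpoints M).Nodup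
  covers : ∀ u, u ∈ endpoints M
  edge : ∀ e ∈ M, I.IsEdge e.fst e.snd
  atime_fst_le : ∀ e ∈ M, I.atime e.fst ≤ e.time
  atime_snd_le : ∀ e ∈ M, I.atime e.snd ≤ e.time

/-- The cost of an optimal offline solution. -/
noncomputable def opt (I : Instance X m) : ℝ := sInf {x | ∃ M, I.IsFeasible M ∧ x = I.cost M}

/-- The right-hand side of the dual constraint of the edge `(u, v)`. -/
def optCost (I : Instance X m) (u v : Fin (2 * m)) : ℝ :=
  dist (I.pos u) (I.pos v) + |I.atime u - I.atime v|

/-- The dual constraint of `(u, v)` holds with equality for the dual solution `y`. -/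
def IsTight (I : Instance X m) (y : Finset (Fin (2 * m)) → ℝ) (u v : Fin (2 * m)) : Prop :=
  ∑ S ∈ univ.filter (fun S : Finset (Fin (2 * m)) => (u ∈ S ∧ v ∉ S) ∨ (v ∈ S ∧ u ∉ S)), y S
    = I.optCost u v

/-- There are arrived requests `u`, `v` in different active sets of `s` such that `(u, v)` is an
edge whose constraint is tight for the dual solution `y`. -/
def TightCrossing (I : Instance X m) (s : GDState m) (y : Finset (Fin (2 * m)) → ℝ)
    (u v : Fin (2 * m)) : Prop :=
  s.HasArrived u ∧ s.HasArrived v ∧ I.IsEdge u v ∧ s.active u ≠ s.active v ∧ I.IsTight y u v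

/-- `I.MatchFree τ S M M'`: starting from the matching `M`, repeatedly matching, at time `τ`, two
free requests of `S` that may be matched, until there are none, can result in the matching `M'`. -/
inductive MatchFree (I : Instance X m) (τ : ℝ) (S : Finset (Fin (2 * m))) :
    List (MatchEdge m) → List (MatchEdge m) → Prop
  | finish (M : List (MatchEdge m))
      (h : ∀ u ∈ freeRequests M S, ∀ v ∈ freeRequests M S, ¬ I.IsEdge u v) :
      MatchFree I τ S M M
  | next (M M' : List (MatchEdge m)) (u v : Fin (2 * m))
      (hu : u ∈ freeRequests M S) (hv : v ∈ freeRequests M S) (huv : I.IsEdge u v)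
      (h : MatchFree I τ S (⟨u, v, τ⟩ :: M) M') :
      MatchFree I τ S M M'

/-- One step of Greedy Dual. Ties (the choice of a tight edge, of the free requests to be matched)
are broken arbitrarily. -/
inductive GDStep (I : Instance X m) : GDState m → GDState m → Prop
  /-- Request arrival: the next request becomes a singleton active set. -/
  | arrive (s : GDState m) (u : Fin (2 * m)) (hu : u.val = s.arrived) (ht : I.atime u = s.time) :
      GDStep I s
        { time := s.time
          arrived := s.arrived + 1
          active := Function.update s.active u {u}
          y := fun S => if u ∈ S then 0 else s.y S
          matching := s.matching }
  /-- Tight constraint: the two active sets are merged, and as many free requests of the union as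
  possible are matched. -/
  | merge (s : GDState m) (u v : Fin (2 * m)) (M' : List (MatchEdge m))
      (huv : I.TightCrossing s s.y u v)
      (hM : I.MatchFree s.time (s.active u ∪ s.active v) s.matching M') :
      GDStep I s
        { time := s.time
          arrived := s.arrived
          active := fun w =>
            if w ∈ s.active u ∪ s.active v then s.active u ∪ s.active v else s.active w
          y := s.y
          matching := M' }
  /-- No event occurs during a period of length `δ`: the dual variables of the growing active sets
  increase at unit rate. The period can end, but not go on, when a request arrives or a constraint
  between two active sets becomes tight. -/
  | elapse (s : GDState m) (δ : ℝ) (hδ : 0 < δ)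
      (harr : ∀ u, ¬ s.HasArrived u → s.time + δ ≤ I.atime u)
      (htight : ∀ r, 0 ≤ r → r < δ → ∀ u v, ¬ I.TightCrossing s (s.grownY r) u v) :
      GDStep I s
        { time := s.time + δ
          arrived := s.arrived
          active := s.active
          y := s.grownY δ
          matching := s.matching }

/-- `M` is the output of a run of Greedy Dual from its initial state until all requests have
arrived and are matched. -/
def GDOutput (I : Instance X m) (M : List (MatchEdge m)) : Prop :=
  ∃ s : GDState m, Relation.ReflTransGen I.GDStep (GDState.initial m) s ∧
    (∀ u, s.HasArrived u) ∧ (∀ u, u ∈ endpoints s.matching) ∧ s.matching = M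

end Instance

/-- Two points `p` and `q` at distance `2`. -/
inductive TwoPoint
  | p
  | q

namespace TwoPoint

noncomputable instance : MetricSpace TwoPoint where
  dist
    | p, p => 0
    | p, q => 2
    | q, p => 2
    | q, q => 0
  dist_self x := by cases x <;> rfl
  dist_comm x y := by cases x <;> cases y <;> rfl
  dist_triangle x y z := by cases x <;> cases y <;> cases z <;> norm_num
  eq_of_dist_eq_zero {x y} h := by cases x <;> cases y <;> simp_all

theorem dist_p_q : dist p q = 2 := rfl

end TwoPoint

/-- The release time of the `k`-th pair (`k = 0, 1, …, m - 1`): `0` for the first pair, and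
`1 + (2k - 1) / m` for the others. -/
noncomputable def pairTime (m k : ℕ) : ℝ :=
  if k = 0 then 0 else 1 + (2 * (k : ℝ) - 1) / m

theorem pairTime_nonneg (m k : ℕ) : 0 ≤ pairTime m k := by
  unfold pairTime
  split_ifs with h
  · exact le_rfl
  · have : (1 : ℝ) ≤ k := by exact_mod_cast Nat.one_le_iff_ne_zero.mpr h
    have : (0 : ℝ) ≤ 2 * (k : ℝ) - 1 := by linarith
    positivity

theorem pairTime_mono (m : ℕ) : Monotone (pairTime m) := by
  intro k l hkl
  by_cases hk : k = 0
  · have h0 : pairTime m k = 0 := by simp [pairTime, hk]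
    rw [h0]
    exact pairTime_nonneg m l
  · have hl : l ≠ 0 := by omega
    have : (k : ℝ) ≤ l := by exact_mod_cast hkl
    simp only [pairTime, hk, hl, if_false]
    gcongr

/-- The requests `2k` and `2k + 1` form the `k`-th pair: they are released at the same time, the
first at `p` and the second at `q`. In the bipartite variant, the polarities at `p` alternate,
starting with a positive request, and those at `q` are opposite to those at `p`. -/
noncomputable def tightInstance (V : Variant) (m : ℕ) : Instance TwoPoint m where
  pos u := if u.val % 2 = 0 then .p else .q
  atime u := pairTime m (u.val / 2)
  sgn u :=
    match V with
    | .mpmd => 0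
    | .mbpmd => if u.val % 2 = 0 then (-1) ^ (u.val / 2) else -(-1) ^ (u.val / 2)
  atime_nonneg u := pairTime_nonneg m _
  atime_mono u v huv := pairTime_mono m (Nat.div_le_div_right huv)

/-! Offline, matching neighbouring requests at the same point costs only waiting, and this waiting
telescopes to less than 4. For odd `m` the last pair is matched across at extra cost 2, so the
optimum is at most 6. Greedy Dual instead always matches across, and its connection cost alone is `2
* m`.

Greedy Dual does so because of an invariant (`GDState.IsSplit`): between pairs, all earlier requests
lie in one fully matched, hence non-growing, active set, and the only nonzero duals are those of
singletons, frozen at the delay `pairDelay` of their pair. The release times are chosen so that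
consecutive delays add up exactly to the gap between consecutive releases
(`pairDelay_add_pairDelay_succ`). Hence a new request `v` becomes tight with its predecessor `v - 2`
at the same point exactly when its own delay ends, and with no older request sooner
(`PairDuals.not_isTight`, `PairDuals.isTight_succ`). For a pair after the first, both new requests
are thus absorbed by the big set at the same moment. The first one absorbed finds no free partner
there, so after the second merge the two can only be matched with each other. The first pair is
tight across after time 1.

`GDState.InPhase.step` shows that every step, under any tie-breaking, preserves this pattern;
`exists_run_pair` builds an actual run. -/

section Offline

/-! ### Offline solutions and bounds on the optimum -/

theorem endpoints_nil (m : ℕ) : endpoints ([] : List (MatchEdge m)) = [] := rfl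

theorem endpoints_cons {m : ℕ} (e : MatchEdge m) (M : List (MatchEdge m)) :
    endpoints (e :: M) = e.fst :: e.snd :: endpoints M := rfl

theorem endpoints_length {m : ℕ} (M : List (MatchEdge m)) :
    (endpoints M).length = 2 * M.length := by
  induction M with
  | nil => rfl
  | cons e M ih => rw [endpoints_cons]; simp [ih]; ring

theorem pairTime_zero (m : ℕ) : pairTime m 0 = 0 := by simp [pairTime]

theorem pairTime_of_ne_zero (m : ℕ) {k : ℕ} (hk : k ≠ 0) :
    pairTime m k = 1 + (2 * (k : ℝ) - 1) / m := by simp [pairTime, hk]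

theorem one_le_pairTime (m : ℕ) {k : ℕ} (hk : k ≠ 0) : 1 ≤ pairTime m k := by
  rw [pairTime_of_ne_zero m hk]
  have : (1 : ℝ) ≤ k := by exact_mod_cast Nat.one_le_iff_ne_zero.mpr hk
  have : (0 : ℝ) ≤ 2 * (k : ℝ) - 1 := by linarith
  have : 0 ≤ (2 * (k : ℝ) - 1) / m := by positivity
  linarith

variable {X : Type*} [MetricSpace X] {m : ℕ}

theorem Instance.cost_cons (I : Instance X m) (e : MatchEdge m) (M : List (MatchEdge m)) :
    I.cost (e :: M) = I.edgeCost e + I.cost M := by simp [Instance.cost]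

/-- The earlier of the two requests waits at least until the later one arrives. -/
theorem Instance.IsFeasible.edgeCost_ge {I : Instance X m} {M : List (MatchEdge m)}
    (hM : I.IsFeasible M) {e : MatchEdge m} (he : e ∈ M) :
    I.optCost e.fst e.snd ≤ I.edgeCost e := by
  have h1 := hM.atime_fst_le e he
  have h2 := hM.atime_snd_le e he
  unfold Instance.optCost Instance.edgeCost
  rcases abs_cases (I.atime e.fst - I.atime e.snd) with h | h <;> linarith [h.1]

theorem Instance.optCost_nonneg (I : Instance X m) (u v : Fin (2 * m)) : 0 ≤ I.optCost u v := by
  unfold Instance.optCost; positivity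

theorem Instance.IsFeasible.connectionCost_le_cost {I : Instance X m} {M : List (MatchEdge m)}
    (hM : I.IsFeasible M) : I.connectionCost M ≤ I.cost M := by
  unfold Instance.connectionCost Instance.cost
  refine List.sum_le_sum fun e he => ?_
  have h1 := hM.atime_fst_le e he
  have h2 := hM.atime_snd_le e he
  unfold Instance.edgeCost
  linarith

theorem Instance.IsFeasible.edgeCost_le_cost {I : Instance X m} {M : List (MatchEdge m)}
    (hM : I.IsFeasible M) {e : MatchEdge m} (he : e ∈ M) : I.edgeCost e ≤ I.cost M := by
  refine List.single_le_sum ?_ _ (List.mem_map_of_mem he)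
  intro x hx
  obtain ⟨e', he', rfl⟩ := List.mem_map.mp hx
  exact (I.optCost_nonneg _ _).trans (hM.edgeCost_ge he')

theorem Instance.IsFeasible.cost_nonneg {I : Instance X m} {M : List (MatchEdge m)}
    (hM : I.IsFeasible M) : 0 ≤ I.cost M := by
  refine List.sum_nonneg ?_
  intro x hx
  obtain ⟨e', he', rfl⟩ := List.mem_map.mp hx
  exact (I.optCost_nonneg _ _).trans (hM.edgeCost_ge he')

theorem Instance.opt_le_cost {I : Instance X m} {M : List (MatchEdge m)}
    (hM : I.IsFeasible M) : I.opt ≤ I.cost M := by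
  refine csInf_le ⟨0, ?_⟩ ⟨M, hM, rfl⟩
  rintro x ⟨M', hM', rfl⟩
  exact hM'.cost_nonneg

theorem mem_endpoints_iff (M : List (MatchEdge m)) (u : Fin (2 * m)) :
    u ∈ endpoints M ↔ ∃ e ∈ M, u = e.fst ∨ u = e.snd := by
  simp [endpoints]

theorem TwoPoint.dist_of_parity_ne {a b : ℕ} (h : a % 2 ≠ b % 2) :
    dist (if a % 2 = 0 then TwoPoint.p else .q) (if b % 2 = 0 then TwoPoint.p else .q) = 2 := by
  rcases Nat.mod_two_eq_zero_or_one a with ha | ha <;>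
    rcases Nat.mod_two_eq_zero_or_one b with hb | hb <;> simp [ha, hb] at h ⊢ <;> rfl

theorem tightInstance_isEdge_succ (V : Variant) {u v : Fin (2 * m)} (h : v.val = u.val + 2) :
    (tightInstance V m).IsEdge u v := by
  refine ⟨by rintro rfl; omega, ?_⟩
  have h1 : v.val / 2 = u.val / 2 + 1 := by omega
  have h2 : v.val % 2 = u.val % 2 := by omega
  cases V
  · simp [tightInstance]
  · simp only [tightInstance, h1, h2, pow_succ]
    split_ifs <;> ring

theorem Instance.IsEdge.symm {I : Instance X m} {u v : Fin (2 * m)} (h : I.IsEdge u v) :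
    I.IsEdge v u := ⟨h.1.symm, by rw [h.2, neg_neg]⟩

theorem tightInstance_isEdge_pair (V : Variant) {u v : Fin (2 * m)} (hne : u ≠ v)
    (h : u.val / 2 = v.val / 2) : (tightInstance V m).IsEdge u v := by
  refine ⟨hne, ?_⟩
  have hne' : u.val ≠ v.val := fun h => hne (Fin.ext h)
  cases V
  · simp [tightInstance]
  · rcases Nat.mod_two_eq_zero_or_one u.val with ha | ha <;>
      rcases Nat.mod_two_eq_zero_or_one v.val with hb | hb
    · omega
    · simp [tightInstance, ha, hb, h]
    · simp [tightInstance, ha, hb, h]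
    · omega

theorem tightInstance_dist_pair (V : Variant) {u v : Fin (2 * m)} (hne : u ≠ v)
    (h : u.val / 2 = v.val / 2) :
    dist ((tightInstance V m).pos u) ((tightInstance V m).pos v) = 2 := by
  have hne' : u.val ≠ v.val := fun h => hne (Fin.ext h)
  exact TwoPoint.dist_of_parity_ne (by omega)

theorem tightInstance_isOf (V : Variant) (m : ℕ) : (tightInstance V m).IsOf V := by
  cases V
  · intro u; rfl
  · have key : ∀ u, (tightInstance .mbpmd m).sgn u = 1 ∨ (tightInstance .mbpmd m).sgn u = -1 := by
      intro u
      simp only [tightInstance]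
      rcases neg_one_pow_eq_or ℤ (u.val / 2) with h | h <;> rw [h] <;> split_ifs <;> simp
    refine ⟨key, ?_⟩
    -- `σ` swaps the two requests of each pair; it is an involution that flips polarity, which gives
    -- the bijection between the signs.
    let σ : Fin (2 * m) → Fin (2 * m) := fun u =>
      ⟨if u.val % 2 = 0 then u.val + 1 else u.val - 1, by have := u.2; split_ifs <;> omega⟩
    have hval : ∀ u, (σ u).val = if u.val % 2 = 0 then u.val + 1 else u.val - 1 := fun u => rfl
    have hσ : ∀ u, σ (σ u) = u := by
      intro u
      apply Fin.ext
      rw [hval, hval]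
      split_ifs <;> omega
    have hs : ∀ u, (tightInstance .mbpmd m).sgn (σ u) = -(tightInstance .mbpmd m).sgn u := by
      intro u
      have hu := hval u
      refine (tightInstance_isEdge_pair .mbpmd (u := σ u) (v := u) ?_ ?_).2
      · intro h
        rw [h] at hu
        split_ifs at hu <;> omega
      · split_ifs at hu <;> omega
    refine Finset.card_bij' (fun u _ => σ u) (fun u _ => σ u) ?_ ?_ ?_ ?_
    · intro u hu
      simp only [mem_filter, mem_univ, true_and] at hu ⊢
      rw [hs, hu]
    · intro u hu
      simp only [mem_filter, mem_univ, true_and] at hu ⊢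
      rw [hs, hu]; rfl
    · intro u _; exact hσ u
    · intro u _; exact hσ u

/-- Request 0 alone forces this: its partner is either the other request of the first pair, at
distance 2, or arrives at time 1 or later. -/
theorem tightInstance_one_le_cost (V : Variant) (hm : 0 < m) {M : List (MatchEdge m)}
    (hM : (tightInstance V m).IsFeasible M) : 1 ≤ (tightInstance V m).cost M := by
  have key : ∀ v : Fin (2 * m), v.val ≠ 0 → 1 ≤ (tightInstance V m).optCost ⟨0, by omega⟩ v := by
    intro v hv
    unfold Instance.optCost
    by_cases hp : v.val / 2 = 0
    · rw [tightInstance_dist_pair V (fun h => hv (congrArg Fin.val h).symm) (by simp [hp])]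
      have := abs_nonneg ((tightInstance V m).atime ⟨0, by omega⟩ - (tightInstance V m).atime v)
      linarith
    · have h1 := one_le_pairTime m hp
      have h2 : |(tightInstance V m).atime ⟨0, by omega⟩ - (tightInstance V m).atime v|
          = pairTime m (v.val / 2) := by
        simp [tightInstance, pairTime_zero, abs_of_nonneg (pairTime_nonneg m _)]
      rw [h2]
      have := dist_nonneg (x := (tightInstance V m).pos ⟨0, by omega⟩)
        (y := (tightInstance V m).pos v)
      linarith
  obtain ⟨e, he, h | h⟩ := (mem_endpoints_iff M _).mp (hM.covers ⟨0, by omega⟩)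
  · refine le_trans ?_ ((hM.edgeCost_ge he).trans (hM.edgeCost_le_cost he))
    have := (hM.edge e he).1
    rw [← h] at this ⊢
    exact key _ fun h0 => this (Fin.ext h0.symm)
  · refine le_trans ?_ ((hM.edgeCost_ge he).trans (hM.edgeCost_le_cost he))
    have := (hM.edge e he).1
    rw [← h] at this ⊢
    refine (key e.fst fun h0 => this (Fin.ext h0)).trans (le_of_eq ?_)
    unfold Instance.optCost
    rw [dist_comm, abs_sub_comm]

theorem tightInstance_dist_succ (V : Variant) {u v : Fin (2 * m)} (h : v.val = u.val + 2) :
    (tightInstance V m).pos u = (tightInstance V m).pos v := by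
  have h2 : v.val % 2 = u.val % 2 := by omega
  simp [tightInstance, h2]

/-- Matching consecutive requests at each point, for the first `2 * n` pairs of requests. -/
theorem exists_local_matching (V : Variant) {n : ℕ} (hn : 2 * n ≤ m) :
    ∃ M : List (MatchEdge m), (endpoints M).Nodup ∧ (∀ u, u ∈ endpoints M ↔ u.val < 4 * n) ∧
      (∀ e ∈ M, Even (e.fst.val / 2) ∧ e.snd.val = e.fst.val + 2 ∧
        e.time = (tightInstance V m).atime e.snd) ∧
      (tightInstance V m).cost M = if n = 0 then 0 else 2 * (1 + (2 * (n : ℝ) - 1) / m) := by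
  induction n with
  | zero => exact ⟨[], by simp [endpoints_nil], by simp [endpoints_nil], by simp,
      by simp [Instance.cost]⟩
  | succ n ih =>
    obtain ⟨M, hnd, hmem, hedge, hcost⟩ := ih (by omega)
    -- The pairs `2 * n` and `2 * n + 1` are matched locally: `i = 0` gives the edge at `p`, `i = 1`
    -- the one at `q`.
    let e : Fin 2 → MatchEdge m := fun i =>
      ⟨⟨4 * n + i.val, by omega⟩, ⟨4 * n + i.val + 2, by omega⟩, pairTime m (2 * n + 1)⟩
    have hat : ∀ i, (tightInstance V m).atime (e i).snd = pairTime m (2 * n + 1) := by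
      intro i
      have : (4 * n + i.val + 2) / 2 = 2 * n + 1 := by omega
      simp [tightInstance, e, this]
    have hat' : ∀ i, (tightInstance V m).atime (e i).fst = pairTime m (2 * n) := by
      intro i
      have : (4 * n + i.val) / 2 = 2 * n := by omega
      simp [tightInstance, e, this]
    have hc : ∀ i, (tightInstance V m).edgeCost (e i)
        = pairTime m (2 * n + 1) - pairTime m (2 * n) := by
      intro i
      rw [Instance.edgeCost, hat, hat', tightInstance_dist_succ V (u := (e i).fst) (v := (e i).snd)
        rfl, dist_self]
      simp [e]
    refine ⟨e 0 :: e 1 :: M, ?_, ?_, ?_, ?_⟩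
    · simp only [endpoints_cons, List.nodup_cons, List.mem_cons, hmem, hnd, e, Fin.ext_iff]
      simp
      omega
    · intro u
      simp only [endpoints_cons, List.mem_cons, hmem, e, Fin.ext_iff]
      simp
      omega
    · intro e' he'
      have : ∀ i, Even ((e i).fst.val / 2) ∧ (e i).snd.val = (e i).fst.val + 2 ∧
          (e i).time = (tightInstance V m).atime (e i).snd := by
        intro i
        refine ⟨⟨n, ?_⟩, rfl, (hat i).symm⟩
        simp only [e]; omega
      simp only [List.mem_cons] at he'
      rcases he' with rfl | rfl | h
      · exact this 0
      · exact this 1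
      · exact hedge _ h
    · rw [Instance.cost_cons, Instance.cost_cons, hc, hc, hcost]
      have hm : (m : ℝ) ≠ 0 := by
        have : m ≠ 0 := by omega
        exact_mod_cast this
      rcases Nat.eq_zero_or_pos n with rfl | h
      -- The first block bridges a release gap of `1 + 1 / m`, every later block one of `2 / m`.
      · simp [pairTime]; ring
      · have : n ≠ 0 := by omega
        simp only [pairTime, this, mul_eq_zero, if_false, or_false, Nat.succ_ne_zero]
        push_cast
        field_simp
        simp
        ring

theorem exists_local_feasible (V : Variant) (hm : 0 < m) (he : Even m) :
    ∃ M, (tightInstance V m).IsFeasible M ∧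
        (∀ e ∈ M, (tightInstance V m).pos e.fst = (tightInstance V m).pos e.snd ∧
          Even (e.fst.val / 2) ∧ e.snd.val = e.fst.val + 2 ∧
          e.time = (tightInstance V m).atime e.snd) ∧
        (tightInstance V m).cost M = 2 * (1 + ((m : ℝ) - 1) / m) ∧
        (tightInstance V m).cost M < 4 := by
  obtain ⟨n, hn⟩ := he
  obtain ⟨M, hnd, hmem, hedge, hcost⟩ := exists_local_matching V (m := m) (n := n) (by omega)
  have hn0 : n ≠ 0 := by omega
  have hmn : (m : ℝ) = n + n := by exact_mod_cast hn
  have hm' : (0 : ℝ) < m := by exact_mod_cast hm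
  have hcost' : (tightInstance V m).cost M = 2 * (1 + ((m : ℝ) - 1) / m) := by
    rw [hcost, if_neg hn0, hmn]; ring
  refine ⟨M, ⟨hnd, ?_, ?_, ?_, ?_⟩, ?_, hcost', ?_⟩
  · intro u; rw [hmem]; omega
  · intro e he; exact tightInstance_isEdge_succ V (hedge e he).2.1
  · intro e he
    rw [(hedge e he).2.2]
    refine (tightInstance V m).atime_mono ?_
    rw [Fin.le_def, (hedge e he).2.1]; omega
  · intro e he; exact (hedge e he).2.2.ge
  · intro e he; exact ⟨tightInstance_dist_succ V (hedge e he).2.1, hedge e he⟩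
  · rw [hcost']
    have : ((m : ℝ) - 1) / m < 1 := by rw [div_lt_one hm']; linarith
    linarith

/-- For odd `m`, the local matching of the first `m - 1` pairs costs at most 4, and the leftover
last pair is matched across on arrival at cost 2. -/
theorem tightInstance_exists_cost_le (V : Variant) (hm : 0 < m) :
    ∃ M, (tightInstance V m).IsFeasible M ∧ (tightInstance V m).cost M ≤ 6 := by
  rcases Nat.even_or_odd m with he | ⟨n, hn⟩
  · obtain ⟨M, h, -, -, h4⟩ := exists_local_feasible V hm he
    exact ⟨M, h, by linarith⟩
  · obtain ⟨M, hnd, hmem, hedge, hcost⟩ := exists_local_matching V (m := m) (n := n) (by omega)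
    let e : MatchEdge m := ⟨⟨4 * n, by omega⟩, ⟨4 * n + 1, by omega⟩, pairTime m (2 * n)⟩
    have h1 : (tightInstance V m).atime e.fst = e.time := by
      have : (4 * n) / 2 = 2 * n := by omega
      simp [tightInstance, e, this]
    have h2 : (tightInstance V m).atime e.snd = e.time := by
      have : (4 * n + 1) / 2 = 2 * n := by omega
      simp [tightInstance, e, this]
    have hne : e.fst ≠ e.snd := by simp [e, Fin.ext_iff]
    have hp : e.fst.val / 2 = e.snd.val / 2 := by simp only [e]; omega
    refine ⟨e :: M, ⟨?_, ?_, ?_, ?_, ?_⟩, ?_⟩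
    · simp only [endpoints_cons, List.nodup_cons, List.mem_cons, hmem, hnd, e, Fin.ext_iff]
      simp
    · intro u
      simp only [endpoints_cons, List.mem_cons, hmem, e, Fin.ext_iff]
      omega
    · intro e' he'
      rcases List.mem_cons.mp he' with rfl | he
      · exact tightInstance_isEdge_pair V hne hp
      · exact tightInstance_isEdge_succ V (hedge _ he).2.1
    · intro e' he'
      rcases List.mem_cons.mp he' with rfl | he
      · exact h1.le
      · rw [(hedge _ he).2.2]
        refine (tightInstance V m).atime_mono ?_
        rw [Fin.le_def, (hedge _ he).2.1]; omega
    · intro e' he'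
      rcases List.mem_cons.mp he' with rfl | he
      · exact h2.le
      · exact (hedge _ he).2.2.ge
    · rw [Instance.cost_cons, Instance.edgeCost, h1, h2, tightInstance_dist_pair V hne hp, hcost]
      have hm' : (0 : ℝ) < m := by exact_mod_cast hm
      split_ifs
      · norm_num
      · have hmn : (m : ℝ) = 2 * n + 1 := by exact_mod_cast hn
        have : (2 * (n : ℝ) - 1) / m ≤ 1 := by rw [div_le_one hm']; linarith
        linarith

theorem tightInstance_opt_pos (V : Variant) (hm : 0 < m) : 0 < (tightInstance V m).opt := by
  obtain ⟨M, hM, -⟩ := tightInstance_exists_cost_le V hm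
  refine lt_of_lt_of_le one_pos (le_csInf ⟨_, M, hM, rfl⟩ ?_)
  rintro x ⟨M', hM', rfl⟩
  exact tightInstance_one_le_cost V hm hM'

theorem tightInstance_opt_le (V : Variant) (hm : 0 < m) : (tightInstance V m).opt ≤ 6 := by
  obtain ⟨M, hM, h⟩ := tightInstance_exists_cost_le V hm
  exact (Instance.opt_le_cost hM).trans h

end Offline

section GreedyDual

/-! ### Dual variables and tight constraints -/

theorem sum_separating {α : Type*} [Fintype α] [DecidableEq α] (y : Finset α → ℝ)
    (hy : ∀ S, S.card ≠ 1 → y S = 0) {u v : α} (huv : u ≠ v) :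
    ∑ S ∈ univ.filter (fun S : Finset α => (u ∈ S ∧ v ∉ S) ∨ (v ∈ S ∧ u ∉ S)), y S
      = y {u} + y {v} := by
  rw [← Finset.sum_pair (f := y) (a := {u}) (b := {v}) (by simpa using huv)]
  symm
  refine Finset.sum_subset ?_ ?_
  · intro S hS
    simp only [mem_insert, mem_singleton] at hS
    rcases hS with rfl | rfl <;> simp [huv, huv.symm]
  · intro S hS hS'
    refine hy S fun hc => hS' ?_
    obtain ⟨w, rfl⟩ := card_eq_one.mp hc
    simp only [mem_filter, mem_univ, true_and, mem_singleton] at hS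
    rcases hS with ⟨rfl, -⟩ | ⟨rfl, -⟩ <;> simp

variable {m : ℕ}

theorem Instance.TightCrossing.symm {X : Type*} [MetricSpace X] {I : Instance X m} {s : GDState m}
    {y : Finset (Fin (2 * m)) → ℝ} {u v : Fin (2 * m)} (h : I.TightCrossing s y u v) :
    I.TightCrossing s y v u := by
  obtain ⟨h1, h2, h3, h4, h5⟩ := h
  refine ⟨h2, h1, h3.symm, h4.symm, ?_⟩
  unfold Instance.IsTight Instance.optCost at h5 ⊢
  rw [dist_comm, abs_sub_comm, ← h5]
  refine Finset.sum_congr (Finset.filter_congr fun S _ => or_comm) fun _ _ => rfl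

theorem Instance.MatchFree.eq_of_no_edge {X : Type*} [MetricSpace X] {I : Instance X m} {τ : ℝ}
    {S : Finset (Fin (2 * m))} {M M' : List (MatchEdge m)} (h : I.MatchFree τ S M M')
    (hM : ∀ u ∈ freeRequests M S, ∀ v ∈ freeRequests M S, ¬ I.IsEdge u v) : M' = M := by
  cases h with
  | finish => rfl
  | next M M' u v hu hv huv h => exact absurd huv (hM u hu v hv)

theorem freeRequests_cons (e : MatchEdge m) (M : List (MatchEdge m)) (S : Finset (Fin (2 * m))) :
    freeRequests (e :: M) S = ((freeRequests M S).erase e.fst).erase e.snd := by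
  ext u
  simp only [freeRequests, endpoints_cons, mem_filter, List.mem_cons, mem_erase, not_or]
  tauto

/-- The time from the release of the `k`-th pair to its matching by Greedy Dual. -/
noncomputable def pairDelay (m k : ℕ) : ℝ := if k = 0 then 1 else 1 / m

theorem pairDelay_pos (hm : 0 < m) (k : ℕ) : 0 < pairDelay m k := by
  unfold pairDelay; split_ifs <;> positivity

/-- Puts the matching times of all pairs, the first included, into one formula. -/
theorem pairTime_add_pairDelay (m k : ℕ) :
    pairTime m k + pairDelay m k = 1 + 2 * (k : ℝ) / m := by
  unfold pairTime pairDelay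
  split_ifs with h
  · simp [h]
  · ring

/-- The defining feature of the instance: the frozen dual of a request and the full delay of its
successor at the same point exactly pay for their edge. -/
theorem pairDelay_add_pairDelay_succ (m k : ℕ) :
    pairDelay m k + pairDelay m (k + 1) = pairTime m (k + 1) - pairTime m k := by
  unfold pairTime pairDelay
  simp only [Nat.succ_ne_zero, if_false]
  split_ifs with h
  · simp [h]; ring
  · push_cast; ring

/-- Pair `k` is released `pairDelay m k` after the matching time of pair `k - 1`, which is no
earlier than that of pair `i`. -/
theorem pairDelay_add_le {i k : ℕ} (h : i < k) :
    pairDelay m i + pairDelay m k ≤ pairTime m k - pairTime m i := by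
  obtain ⟨j, rfl⟩ : ∃ j, k = j + 1 := ⟨k - 1, by omega⟩
  have h1 := pairTime_add_pairDelay m i
  have h2 := pairTime_add_pairDelay m j
  have h3 := pairDelay_add_pairDelay_succ m j
  have h4 : (i : ℝ) ≤ j := by exact_mod_cast Nat.lt_succ_iff.mp h
  have h5 : 2 * (i : ℝ) / m ≤ 2 * (j : ℝ) / m := by gcongr
  linarith

/-- The first `n` requests. -/
def firstRequests (m n : ℕ) : Finset (Fin (2 * m)) := univ.filter fun u => u.val < n

theorem mem_firstRequests {n : ℕ} {u : Fin (2 * m)} : u ∈ firstRequests m n ↔ u.val < n := by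
  simp [firstRequests]

/-- The dual variables while the `k`-th pair waits for `r` time units, `n` requests having
arrived. -/
structure PairDuals (m k n : ℕ) (r : ℝ) (y : Finset (Fin (2 * m)) → ℝ) : Prop where
  old : ∀ u : Fin (2 * m), u.val < 2 * k → y {u} = pairDelay m (u.val / 2)
  new : ∀ u : Fin (2 * m), u.val < n → 2 * k ≤ u.val → y {u} = r
  other : ∀ S, S.card ≠ 1 → y S = 0

/-- `M` matches the two requests of each of the first `k` pairs, at the time of Greedy Dual. -/
structure PairsMatched (m k : ℕ) (M : List (MatchEdge m)) : Prop where
  nodup : (endpoints M).Nodup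
  mem_iff : ∀ u, u ∈ endpoints M ↔ u.val < 2 * k
  ne : ∀ e ∈ M, e.fst ≠ e.snd
  same_pair : ∀ e ∈ M, e.fst.val / 2 = e.snd.val / 2
  time_eq : ∀ e ∈ M, e.time = 1 + 2 * ((e.fst.val / 2 : ℕ) : ℝ) / m

theorem PairDuals.isTight_iff {k n : ℕ} {r : ℝ} {y : Finset (Fin (2 * m)) → ℝ}
    (h : PairDuals m k n r y) {X : Type*} [MetricSpace X] (I : Instance X m) {u v : Fin (2 * m)}
    (huv : u ≠ v) : I.IsTight y u v ↔ y {u} + y {v} = I.optCost u v := by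
  rw [Instance.IsTight, sum_separating y h.other huv]

/-- While the `k`-th pair waits, constraints become tight only at the end of its delay. -/
theorem PairDuals.not_isTight {k n : ℕ} {r : ℝ} {y : Finset (Fin (2 * m)) → ℝ} (V : Variant)
    (h : PairDuals m k n r y) (hk : k < m) (hn : n ≤ 2 * k + 2) (hr : r ≤ pairDelay m k)
    {u v : Fin (2 * m)} (huv : u.val < v.val) (hv : v.val < n) (hkv : 2 * k ≤ v.val)
    (ht : (tightInstance V m).IsTight y u v) :
    r = pairDelay m k ∧ (u.val < 2 * k ∨ k = 0) := by
  have hne : u ≠ v := fun h => by rw [h] at huv; omega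
  rw [h.isTight_iff _ hne, h.new v hv hkv] at ht
  have hv2 : v.val / 2 = k := by omega
  by_cases hu : u.val < 2 * k
  · refine ⟨le_antisymm hr ?_, Or.inl hu⟩
    have h1 := pairDelay_add_le (m := m) (i := u.val / 2) (k := k) (by omega)
    rw [h.old u hu] at ht
    have h2 : pairTime m k - pairTime m (u.val / 2) ≤ (tightInstance V m).optCost u v := by
      unfold Instance.optCost
      have h3 : (tightInstance V m).atime v = pairTime m k := by rw [← hv2]; rfl
      have h4 : (tightInstance V m).atime u = pairTime m (u.val / 2) := rfl
      rw [h3, h4, abs_sub_comm]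
      have := le_abs_self (pairTime m k - pairTime m (u.val / 2))
      have := dist_nonneg (x := (tightInstance V m).pos u) (y := (tightInstance V m).pos v)
      linarith
    linarith
  · have hu2 : u.val / 2 = v.val / 2 := by omega
    rw [h.new u (by omega) (by omega), Instance.optCost, tightInstance_dist_pair V hne hu2] at ht
    have h0 : (tightInstance V m).atime u = (tightInstance V m).atime v := by
      simp [tightInstance, hu2]
    rw [h0, sub_self, abs_zero] at ht
    -- Tightness inside the pair means `2 * r = 2`. For `k ≠ 0` there are at least two pairs, so `r
    -- ≤ 1 / m < 1` rules this out.
    have hk0 : k = 0 := by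
      by_contra hk0
      have hm : (2 : ℝ) ≤ m := by exact_mod_cast (by omega : 2 ≤ m)
      have : (1 : ℝ) / m < 1 := by rw [div_lt_one (by linarith)]; linarith
      rw [pairDelay, if_neg hk0] at hr
      linarith
    refine ⟨?_, Or.inr hk0⟩
    rw [pairDelay, if_pos hk0]; linarith

/-- At the end of the delay of the `k`-th pair, its requests have tight edges to the requests of
the previous pair. -/
theorem PairDuals.isTight_succ {k n : ℕ} {y : Finset (Fin (2 * m)) → ℝ} (V : Variant)
    (h : PairDuals m k n (pairDelay m k) y) {u v : Fin (2 * m)} (huv : v.val = u.val + 2)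
    (hv : v.val < n) (hkv : v.val / 2 = k) : (tightInstance V m).IsTight y u v := by
  have hne : u ≠ v := fun h => by rw [h] at huv; omega
  rw [h.isTight_iff _ hne, h.new v hv (by omega), h.old u (by omega), Instance.optCost,
    tightInstance_dist_succ V huv, dist_self]
  have h3 : (tightInstance V m).atime v = pairTime m (u.val / 2 + 1) := by
    have : v.val / 2 = u.val / 2 + 1 := by omega
    rw [← this]; rfl
  have h4 : (tightInstance V m).atime u = pairTime m (u.val / 2) := rfl
  have h5 : k = u.val / 2 + 1 := by omega
  rw [h3, h4, abs_sub_comm, abs_of_nonneg (sub_nonneg.mpr (pairTime_mono m (by omega))), h5,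
    pairDelay_add_pairDelay_succ]
  ring

theorem PairDuals.isTight_first {n : ℕ} {y : Finset (Fin (2 * m)) → ℝ} (V : Variant)
    (h : PairDuals m 0 n (pairDelay m 0) y) {u v : Fin (2 * m)} (huv : u ≠ v)
    (hun : u.val < n) (hvn : v.val < n) (hu : u.val < 2) (hv : v.val < 2) :
    (tightInstance V m).IsTight y u v := by
  have hu2 : u.val / 2 = v.val / 2 := by omega
  rw [h.isTight_iff _ huv, h.new u hun (by omega), h.new v hvn (by omega), Instance.optCost,
    tightInstance_dist_pair V huv hu2]
  simp [tightInstance, hu2, pairDelay]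
  norm_num

/-- The first `k` pairs form an active set and are matched, and the later ones among the `n`
arrived requests are singletons that have waited for `r` time units. -/
structure GDState.IsSplit (s : GDState m) (k n : ℕ) (r : ℝ) : Prop where
  arrived_eq : s.arrived = n
  active_eq : ∀ u : Fin (2 * m), u.val < n →
    s.active u = if u.val < 2 * k then firstRequests m (2 * k) else {u}
  duals : PairDuals m k n r s.y
  pairs : PairsMatched m k s.matching

/-- One request `x` of the `k`-th pair has joined the active set of the first `k` pairs, and the
other one, `z`, is still a singleton. -/
structure GDState.IsMerging (s : GDState m) (k : ℕ) (x z : Fin (2 * m)) : Prop where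
  pos : k ≠ 0
  arrived_eq : s.arrived = 2 * k + 2
  x_pair : x.val / 2 = k
  z_pair : z.val / 2 = k
  ne : x ≠ z
  active_x : ∀ u : Fin (2 * m), u.val < 2 * k + 2 → u ≠ z →
    s.active u = insert x (firstRequests m (2 * k))
  active_z : s.active z = {z}
  duals : PairDuals m k (2 * k + 2) (pairDelay m k) s.y
  pairs : PairsMatched m k s.matching
  time_eq : s.time = pairTime m k + pairDelay m k

/-! ### Effect of arrivals and of elapsed time on the invariant -/

namespace GDState

variable {s : GDState m} {k n : ℕ} {r : ℝ}

theorem initial_isSplit (m : ℕ) : (initial m).IsSplit 0 0 0 where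
  arrived_eq := rfl
  active_eq u hu := absurd hu (Nat.not_lt_zero _)
  duals := ⟨fun u hu => absurd hu (Nat.not_lt_zero _), fun _ _ _ => rfl, fun _ _ => rfl⟩
  pairs := ⟨by simp [initial, endpoints_nil], by simp [initial, endpoints_nil], by simp [initial],
    by simp [initial], by simp [initial]⟩

/-- With no unmatched arrival, the waiting time is a vacuous parameter. -/
theorem IsSplit.rest (h : s.IsSplit k (2 * k) r) (r' : ℝ) : s.IsSplit k (2 * k) r' :=
  ⟨h.arrived_eq, h.active_eq, ⟨h.duals.old, fun _ h1 h2 => absurd h1 (not_lt.mpr h2),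
    h.duals.other⟩, h.pairs⟩

/-- The state after the arrival of `u`. -/
def afterArrival (s : GDState m) (u : Fin (2 * m)) : GDState m where
  time := s.time
  arrived := s.arrived + 1
  active := Function.update s.active u {u}
  y := fun S => if u ∈ S then 0 else s.y S
  matching := s.matching

/-- The state after `δ` time units without events. -/
noncomputable def afterElapse (s : GDState m) (δ : ℝ) : GDState m where
  time := s.time + δ
  arrived := s.arrived
  active := s.active
  y := s.grownY δ
  matching := s.matching

/-- The state after merging the active sets of `u` and `v`, with the new matching `M'`. -/
def afterMerge (s : GDState m) (u v : Fin (2 * m)) (M' : List (MatchEdge m)) : GDState m where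
  time := s.time
  arrived := s.arrived
  active := fun w =>
    if w ∈ s.active u ∪ s.active v then s.active u ∪ s.active v else s.active w
  y := s.y
  matching := M'

/-- The waiting time is 0 since the new request starts with dual 0 and must share its value with any
partner already present. The reset of sets containing `u` affects no older singleton. -/
theorem IsSplit.afterArrival (h : s.IsSplit k n 0) {u : Fin (2 * m)} (hu : u.val = n)
    (hkn : 2 * k ≤ n) : (s.afterArrival u).IsSplit k (n + 1) 0 where
  arrived_eq := by simp [GDState.afterArrival, h.arrived_eq]
  active_eq w hw := by
    by_cases hwu : w = u
    · subst hwu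
      rw [if_neg (by omega)]
      simp [GDState.afterArrival]
    · have : w.val ≠ u.val := fun h => hwu (Fin.ext h)
      rw [← h.active_eq w (by omega)]
      simp [GDState.afterArrival, hwu]
  duals :=
    { old := fun w hw => by
        have : u ≠ w := fun h => by rw [h] at hu; omega
        simpa [GDState.afterArrival, this] using h.duals.old w hw
      new := fun w hw hkw => by
        by_cases hwu : u = w
        · simp [GDState.afterArrival, hwu]
        · have : w.val ≠ u.val := fun h => hwu (Fin.ext h.symm)
          simpa [GDState.afterArrival, hwu] using h.duals.new w (by omega) hkw
      other := fun S hS => by simp [GDState.afterArrival, h.duals.other S hS] }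
  pairs := h.pairs

/-- The big set has no free request, so only waiting singletons grow; this keeps the duals of all
other sets at 0. -/
theorem IsSplit.mem_growingSets (h : s.IsSplit k n r) {S : Finset (Fin (2 * m))} :
    S ∈ s.growingSets ↔ ∃ u : Fin (2 * m), u.val < n ∧ 2 * k ≤ u.val ∧ S = {u} := by
  simp only [growingSets, mem_filter, mem_image, mem_univ, true_and, h.arrived_eq]
  constructor
  · rintro ⟨⟨u, hu, rfl⟩, w, hw⟩
    rw [h.active_eq u hu] at hw ⊢
    by_cases huk : u.val < 2 * k
    · rw [if_pos huk, freeRequests, mem_filter, mem_firstRequests, h.pairs.mem_iff] at hw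
      exact absurd hw.1 hw.2
    · exact ⟨u, hu, not_lt.mp huk, if_neg huk⟩
  · rintro ⟨u, hu, huk, rfl⟩
    refine ⟨⟨u, hu, by rw [h.active_eq u hu, if_neg (not_lt.mpr huk)]⟩, u, ?_⟩
    rw [freeRequests, mem_filter, h.pairs.mem_iff]
    simpa using huk

theorem IsSplit.grownY_duals (h : s.IsSplit k n r) (δ : ℝ) :
    PairDuals m k n (r + δ) (s.grownY δ) where
  old u hu := by
    rw [grownY, if_neg, h.duals.old u hu]
    rw [h.mem_growingSets]
    rintro ⟨w, hw, hkw, huw⟩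
    rw [singleton_inj.mp huw] at hu
    omega
  new u hu hku := by
    rw [grownY, if_pos (h.mem_growingSets.mpr ⟨u, hu, hku, rfl⟩), h.duals.new u hu hku]
  other S hS := by
    rw [grownY, if_neg, h.duals.other S hS]
    rw [h.mem_growingSets]
    rintro ⟨w, hw, hkw, rfl⟩
    simp at hS

theorem IsSplit.afterElapse (h : s.IsSplit k n r) (δ : ℝ) :
    (s.afterElapse δ).IsSplit k n (r + δ) :=
  ⟨h.arrived_eq, h.active_eq, h.grownY_duals δ, h.pairs⟩

/-- A tight constraint between different active sets requires that the `k`-th pair has waited for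
its whole delay. -/
theorem IsSplit.tightCrossing_ordered (h : s.IsSplit k n r) (V : Variant) (hk : k < m)
    (hn : n ≤ 2 * k + 2) {r' : ℝ} {y : Finset (Fin (2 * m)) → ℝ} (hy : PairDuals m k n r' y)
    (hr : r' ≤ pairDelay m k) {u v : Fin (2 * m)} (huv : u.val < v.val)
    (ht : (tightInstance V m).TightCrossing s y u v) :
    r' = pairDelay m k ∧ 2 * k ≤ v.val ∧ (u.val < 2 * k ∨ k = 0) := by
  obtain ⟨h1, h2, -, h4, h5⟩ := ht
  rw [HasArrived, h.arrived_eq] at h1 h2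
  have hkv : 2 * k ≤ v.val := by
    by_contra hkv
    rw [h.active_eq u h1, h.active_eq v h2, if_pos (by omega), if_pos (by omega)] at h4
    exact h4 rfl
  have := hy.not_isTight V hk hn hr huv h2 hkv h5
  exact ⟨this.1, hkv, this.2⟩

theorem IsSplit.not_tightCrossing (h : s.IsSplit k n r) (V : Variant) (hk : k < m)
    (hn : n ≤ 2 * k + 2) {r' : ℝ} {y : Finset (Fin (2 * m)) → ℝ} (hy : PairDuals m k n r' y)
    (hr : r' < pairDelay m k) (u v : Fin (2 * m)) :
    ¬ (tightInstance V m).TightCrossing s y u v := by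
  intro ht
  rcases lt_trichotomy u.val v.val with huv | huv | huv
  · exact hr.ne (h.tightCrossing_ordered V hk hn hy hr.le huv ht).1
  · exact ht.2.2.1.1 (Fin.ext huv)
  · exact hr.ne (h.tightCrossing_ordered V hk hn hy hr.le huv ht.symm).1

theorem IsSplit.not_tightCrossing_rest (h : s.IsSplit k (2 * k) r) (V : Variant)
    (y : Finset (Fin (2 * m)) → ℝ) (u v : Fin (2 * m)) :
    ¬ (tightInstance V m).TightCrossing s y u v := by
  rintro ⟨h1, h2, -, h4, -⟩
  rw [HasArrived, h.arrived_eq] at h1 h2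
  rw [h.active_eq u h1, h.active_eq v h2, if_pos h1, if_pos h2] at h4
  exact h4 rfl

/-- Guarantees that waiting cannot outlast the delay: the witness is the first pair itself if `k =
0`, and otherwise the edge at `p` to the previous pair. -/
theorem IsSplit.exists_tightCrossing (h : s.IsSplit k (2 * k + 2) r) (V : Variant) (hk : k < m)
    {y : Finset (Fin (2 * m)) → ℝ} (hy : PairDuals m k (2 * k + 2) (pairDelay m k) y) :
    ∃ u v, (tightInstance V m).TightCrossing s y u v := by
  rcases Nat.eq_zero_or_pos k with rfl | hk0
  · have hne : (⟨0, by omega⟩ : Fin (2 * m)) ≠ ⟨1, by omega⟩ := by simp [Fin.ext_iff]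
    refine ⟨⟨0, by omega⟩, ⟨1, by omega⟩, ?_, ?_, tightInstance_isEdge_pair V hne (by simp), ?_,
      hy.isTight_first V hne (by simp) (by simp) (by simp) (by simp)⟩
    · simp [HasArrived, h.arrived_eq]
    · simp [HasArrived, h.arrived_eq]
    · rw [h.active_eq _ (by simp), h.active_eq _ (by simp)]
      simp
  · have hval : (⟨2 * k, by omega⟩ : Fin (2 * m)).val
        = (⟨2 * k - 2, by omega⟩ : Fin (2 * m)).val + 2 := by simp; omega
    refine ⟨⟨2 * k - 2, by omega⟩, ⟨2 * k, by omega⟩, ?_, ?_, tightInstance_isEdge_succ V hval, ?_,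
      hy.isTight_succ V hval (by simp) (by simp)⟩
    · simp only [HasArrived, h.arrived_eq]; omega
    · simp only [HasArrived, h.arrived_eq]; omega
    · rw [h.active_eq _ (by simp; omega), h.active_eq _ (by simp), if_pos (by simp; omega),
        if_neg (by simp)]
      intro heq
      have h1 : (⟨2 * k, by omega⟩ : Fin (2 * m)) ∈ firstRequests m (2 * k) := by rw [heq]; simp
      rw [mem_firstRequests] at h1
      simp at h1

/-- Absorbing `x` leaves the edge from `z` to its predecessor tight and crossing, so no time can
pass before `z` is absorbed too. -/
theorem IsMerging.tightCrossing (h : s.IsMerging k x z) (V : Variant) {y : Finset (Fin (2 * m)) → ℝ}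
    (hy : PairDuals m k (2 * k + 2) (pairDelay m k) y) :
    ∃ u, (tightInstance V m).TightCrossing s y u z := by
  have hz := h.z_pair
  have hk := h.pos
  have hval : z.val = (⟨z.val - 2, by omega⟩ : Fin (2 * m)).val + 2 := by simp; omega
  refine ⟨⟨z.val - 2, by omega⟩, ?_, ?_, tightInstance_isEdge_succ V hval, ?_,
    hy.isTight_succ V hval (by omega) h.z_pair⟩
  · simp only [HasArrived, h.arrived_eq]; omega
  · simp only [HasArrived, h.arrived_eq]; omega
  · rw [h.active_z, h.active_x _ (by simp; omega) (by simp [Fin.ext_iff]; omega)]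
    intro heq
    have h1 : x ∈ ({z} : Finset (Fin (2 * m))) := by rw [← heq]; simp
    exact h.ne (mem_singleton.mp h1)

end GDState

/-! ### Matching the two free requests of a merged set -/

theorem firstRequests_add_two {k : ℕ} {x z : Fin (2 * m)} (hx : x.val / 2 = k)
    (hz : z.val / 2 = k) (hne : x ≠ z) :
    firstRequests m (2 * k + 2) = insert z (insert x (firstRequests m (2 * k))) := by
  have hne' : x.val ≠ z.val := fun h => hne (Fin.ext h)
  ext w
  simp only [mem_insert, mem_firstRequests, Fin.ext_iff]
  omega

theorem PairsMatched.freeRequests_eq {k n : ℕ} {M : List (MatchEdge m)} (h : PairsMatched m k M)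
    {x z : Fin (2 * m)} (hx : x.val / 2 = k) (hz : z.val / 2 = k) (hne : x ≠ z)
    (hn : n = 2 * k + 2) : freeRequests M (firstRequests m n) = {x, z} := by
  have hne' : x.val ≠ z.val := fun h => hne (Fin.ext h)
  ext w
  simp only [freeRequests, mem_filter, h.mem_iff, mem_insert, mem_singleton, mem_firstRequests,
    Fin.ext_iff]
  omega

theorem PairsMatched.cons {k : ℕ} {M : List (MatchEdge m)} (h : PairsMatched m k M)
    {x z : Fin (2 * m)} (hx : x.val / 2 = k) (hz : z.val / 2 = k) (hne : x ≠ z) {τ : ℝ}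
    (hτ : τ = pairTime m k + pairDelay m k) : PairsMatched m (k + 1) (⟨x, z, τ⟩ :: M) := by
  have hne' : x.val ≠ z.val := fun h => hne (Fin.ext h)
  refine ⟨?_, ?_, ?_, ?_, ?_⟩
  · simp only [endpoints_cons, List.nodup_cons, List.mem_cons, h.mem_iff, h.nodup, Fin.ext_iff]
    exact ⟨by omega, by omega, trivial⟩
  · intro w
    simp only [endpoints_cons, List.mem_cons, h.mem_iff, Fin.ext_iff]
    omega
  · intro e he
    rcases List.mem_cons.mp he with rfl | he
    · exact hne
    · exact h.ne e he
  · intro e he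
    rcases List.mem_cons.mp he with rfl | he
    · exact hx.trans hz.symm
    · exact h.same_pair e he
  · intro e he
    rcases List.mem_cons.mp he with rfl | he
    · simp only [hx, hτ, pairTime_add_pairDelay]
    · exact h.time_eq e he

/-- If the free requests of `S` are those of the `k`-th pair, they are matched with each other. -/
theorem PairsMatched.matchFree {k : ℕ} {M M' : List (MatchEdge m)} (V : Variant)
    (h : PairsMatched m k M) {τ : ℝ} (hτ : τ = pairTime m k + pairDelay m k)
    {x z : Fin (2 * m)} (hx : x.val / 2 = k) (hz : z.val / 2 = k) (hne : x ≠ z)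
    {S : Finset (Fin (2 * m))} (hS : freeRequests M S = {x, z})
    (hM : (tightInstance V m).MatchFree τ S M M') : PairsMatched m (k + 1) M' := by
  cases hM with
  | finish _ hno =>
    exact absurd (tightInstance_isEdge_pair V hne (hx.trans hz.symm))
      (hno x (by simp [hS]) z (by simp [hS]))
  | next _ _ u v hu hv huv hM =>
    have huv' := huv.1
    rw [hS, mem_insert, mem_singleton] at hu hv
    have hfree : freeRequests (⟨u, v, τ⟩ :: M) S = ∅ := by
      rw [freeRequests_cons, hS]
      ext w
      simp only [mem_erase, mem_insert, mem_singleton, notMem_empty, iff_false]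
      rcases hu with rfl | rfl <;> rcases hv with rfl | rfl <;> tauto
    rw [hM.eq_of_no_edge (by simp [hfree])]
    refine h.cons ?_ ?_ huv' hτ
    · rcases hu with rfl | rfl <;> assumption
    · rcases hv with rfl | rfl <;> assumption

theorem exists_matchFree_pair {k : ℕ} {M : List (MatchEdge m)} (V : Variant) (τ : ℝ)
    {x z : Fin (2 * m)} (hx : x.val / 2 = k) (hz : z.val / 2 = k) (hne : x ≠ z)
    {S : Finset (Fin (2 * m))} (hS : freeRequests M S = {x, z}) :
    ∃ M', (tightInstance V m).MatchFree τ S M M' := by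
  refine ⟨_, .next M _ x z (by simp [hS]) (by simp [hS])
    (tightInstance_isEdge_pair V hne (hx.trans hz.symm)) (.finish _ ?_)⟩
  have hfree : freeRequests (⟨x, z, τ⟩ :: M) S = ∅ := by
    rw [freeRequests_cons, hS]
    ext w
    simp only [mem_erase, mem_insert, mem_singleton, notMem_empty, iff_false]
    tauto
  simp [hfree]

end GreedyDual

/-! ### Merge steps and the phases of a run -/

section GreedyDualRuns

variable {m : ℕ}

/-- When the delay ends, the common value of the waiting pair is exactly the value at which its
duals freeze. -/
theorem PairDuals.succ {k : ℕ} {y : Finset (Fin (2 * m)) → ℝ}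
    (h : PairDuals m k (2 * k + 2) (pairDelay m k) y) (r : ℝ) :
    PairDuals m (k + 1) (2 * (k + 1)) r y where
  old u hu := by
    by_cases huk : u.val < 2 * k
    · exact h.old u huk
    · have : u.val / 2 = k := by omega
      rw [h.new u (by omega) (by omega), this]
  new u h1 h2 := by omega
  other := h.other

theorem PairsMatched.freeRequests_insert {k : ℕ} {M : List (MatchEdge m)} (h : PairsMatched m k M)
    {v : Fin (2 * m)} : freeRequests M (insert v (firstRequests m (2 * k))) ⊆ {v} := by
  intro w hw
  rw [freeRequests, mem_filter, mem_insert, mem_firstRequests, h.mem_iff] at hw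
  rw [mem_singleton]
  tauto

namespace GDState

variable {s : GDState m} {k : ℕ} {r : ℝ}

theorem afterMerge_comm (s : GDState m) (u v : Fin (2 * m)) (M' : List (MatchEdge m)) :
    s.afterMerge u v M' = s.afterMerge v u M' := by
  simp only [afterMerge, union_comm]

/-- Once the `k`-th pair is in one active set with all previous ones, it is matched. -/
theorem isSplit_afterMerge (V : Variant) (hk : k < m) (harr : s.arrived = 2 * k + 2)
    (hy : PairDuals m k (2 * k + 2) (pairDelay m k) s.y) (hM : PairsMatched m k s.matching)
    (ht : s.time = pairTime m k + pairDelay m k) {u v : Fin (2 * m)}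
    (huv : s.active u ∪ s.active v = firstRequests m (2 * k + 2)) {M' : List (MatchEdge m)}
    (hM' : (tightInstance V m).MatchFree s.time (s.active u ∪ s.active v) s.matching M') :
    (s.afterMerge u v M').IsSplit (k + 1) (2 * (k + 1)) 0 where
  arrived_eq := harr
  active_eq w hw := by
    have hw' : w ∈ firstRequests m (2 * k + 2) := mem_firstRequests.mpr hw
    simp only [afterMerge, huv]
    rw [if_pos hw', if_pos hw]
    rfl
  duals := hy.succ 0
  pairs := by
    have hx : (⟨2 * k, by omega⟩ : Fin (2 * m)).val / 2 = k := by simp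
    have hz : (⟨2 * k + 1, by omega⟩ : Fin (2 * m)).val / 2 = k := by simp only; omega
    have hne : (⟨2 * k, by omega⟩ : Fin (2 * m)) ≠ ⟨2 * k + 1, by omega⟩ := by simp [Fin.ext_iff]
    refine hM.matchFree V ht hx hz hne ?_ hM'
    rw [huv]
    exact hM.freeRequests_eq hx hz hne rfl

theorem IsSplit.union_active_first (h : s.IsSplit 0 (2 * 0 + 2) r) {u v : Fin (2 * m)}
    (hu : u.val < 2) (hv : v.val < 2) (huv : u ≠ v) :
    s.active u ∪ s.active v = firstRequests m (2 * 0 + 2) := by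
  rw [h.active_eq u hu, h.active_eq v hv, if_neg (by omega), if_neg (by omega),
    firstRequests_add_two (k := 0) (x := v) (z := u) (by omega) (by omega) huv.symm]
  ext w
  simp [mem_firstRequests]

theorem IsSplit.union_active (h : s.IsSplit k (2 * k + 2) r) {u v : Fin (2 * m)}
    (hu : u.val < 2 * k) (hv : v.val / 2 = k) :
    s.active u ∪ s.active v = insert v (firstRequests m (2 * k)) := by
  rw [h.active_eq u (by omega), h.active_eq v (by omega), if_pos hu, if_neg (by omega)]
  ext w
  simp

/-- Only `v` can be free in this set, so the first merge matches nothing. -/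
theorem IsSplit.no_edge_insert (h : s.IsSplit k (2 * k + 2) r) (V : Variant) {v : Fin (2 * m)} :
    ∀ a ∈ freeRequests s.matching (insert v (firstRequests m (2 * k))),
      ∀ b ∈ freeRequests s.matching (insert v (firstRequests m (2 * k))),
        ¬ (tightInstance V m).IsEdge a b := by
  intro a ha b hb hab
  have ha' := mem_singleton.mp (h.pairs.freeRequests_insert ha)
  have hb' := mem_singleton.mp (h.pairs.freeRequests_insert hb)
  exact hab.1 (ha'.trans hb'.symm)

theorem IsSplit.isMerging_afterMerge (h : s.IsSplit k (2 * k + 2) (pairDelay m k)) (V : Variant)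
    (ht : s.time = pairTime m k + pairDelay m k) {u v z : Fin (2 * m)}
    (hu : u.val < 2 * k) (hv : v.val / 2 = k) (hz : z.val / 2 = k) (hvz : v ≠ z)
    {M' : List (MatchEdge m)}
    (hM' : (tightInstance V m).MatchFree s.time (s.active u ∪ s.active v) s.matching M') :
    (s.afterMerge u v M').IsMerging k v z := by
  have hun := h.union_active hu hv
  rw [hun] at hM'
  have hMM := hM'.eq_of_no_edge (h.no_edge_insert V)
  have hz2 : z ∉ insert v (firstRequests m (2 * k)) := by
    rw [mem_insert, mem_firstRequests, not_or]
    exact ⟨hvz.symm, by omega⟩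
  have hne' : v.val ≠ z.val := fun h => hvz (Fin.ext h)
  refine ⟨by omega, h.arrived_eq, hv, hz, hvz, ?_, ?_, h.duals, ?_, ht⟩
  · intro w hw hwz
    have hwz' : w.val ≠ z.val := fun h => hwz (Fin.ext h)
    have : w ∈ insert v (firstRequests m (2 * k)) := by
      rw [mem_insert, mem_firstRequests, Fin.ext_iff]; omega
    simp only [afterMerge, hun, if_pos this]
  · simp only [afterMerge, hun, if_neg hz2]
    rw [h.active_eq z (by omega), if_neg (by omega)]
  · simp only [afterMerge, hMM, h.pairs]

/-- All arrived requests except `z` share one active set, so any crossing edge ends at `z`; the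
choice of tight edge is irrelevant. -/
theorem IsMerging.isSplit_afterMerge {x z : Fin (2 * m)} (h : s.IsMerging k x z) (V : Variant)
    {u v : Fin (2 * m)} (huv : (tightInstance V m).TightCrossing s s.y u v)
    {M' : List (MatchEdge m)}
    (hM' : (tightInstance V m).MatchFree s.time (s.active u ∪ s.active v) s.matching M') :
    (s.afterMerge u v M').IsSplit (k + 1) (2 * (k + 1)) 0 := by
  have hk : k < m := by have := h.x_pair; omega
  obtain ⟨h1, h2, -, h4, -⟩ := huv
  rw [HasArrived, h.arrived_eq] at h1 h2
  refine GDState.isSplit_afterMerge V hk h.arrived_eq h.duals h.pairs h.time_eq ?_ hM'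
  have key : insert x (firstRequests m (2 * k)) ∪ {z} = firstRequests m (2 * k + 2) := by
    rw [firstRequests_add_two h.x_pair h.z_pair h.ne, union_comm]; rfl
  by_cases hu : u = z
  · by_cases hv : v = z
    · exact absurd (by rw [hu, hv]) h4
    · rw [h.active_x v h2 hv, hu, h.active_z, union_comm, key]
  · by_cases hv : v = z
    · rw [h.active_x u h1 hu, hv, h.active_z, key]
    · exact absurd (by rw [h.active_x u h1 hu, h.active_x v h2 hv]) h4

/-- The phases that a run of Greedy Dual goes through. -/
inductive InPhase (s : GDState m) : Prop
  | idle (k : ℕ) (hk : k ≤ m) (h : s.IsSplit k (2 * k) 0)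
  | arriving (k : ℕ) (hk : k < m) (h : s.IsSplit k (2 * k + 1) 0) (ht : s.time = pairTime m k)
  | waiting (k : ℕ) (r : ℝ) (hk : k < m) (h : s.IsSplit k (2 * k + 2) r) (hr : r ≤ pairDelay m k)
      (ht : s.time = pairTime m k + r)
  | merging (k : ℕ) (x z : Fin (2 * m)) (h : s.IsMerging k x z)

theorem IsSplit.inPhase_afterMerge (h : s.IsSplit k (2 * k + 2) r) (V : Variant) (hk : k < m)
    (hr : r ≤ pairDelay m k) (ht : s.time = pairTime m k + r) {u v : Fin (2 * m)}
    (hlt : u.val < v.val) (huv : (tightInstance V m).TightCrossing s s.y u v)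
    {M' : List (MatchEdge m)}
    (hM' : (tightInstance V m).MatchFree s.time (s.active u ∪ s.active v) s.matching M') :
    (s.afterMerge u v M').InPhase := by
  obtain ⟨rfl, hv, hu⟩ := h.tightCrossing_ordered V hk le_rfl h.duals hr hlt huv
  have hv2 : v.val < 2 * k + 2 := by
    have := huv.2.1
    rwa [HasArrived, h.arrived_eq] at this
  by_cases huk : u.val < 2 * k
  -- The requests of the pair are `2 * k` and `2 * k + 1`, so `4 * k + 1 - v` is the partner of `v`.
  · have hz : (⟨4 * k + 1 - v.val, by omega⟩ : Fin (2 * m)).val = 4 * k + 1 - v.val := rfl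
    refine .merging k v _ (h.isMerging_afterMerge V ht (z := ⟨4 * k + 1 - v.val, by omega⟩)
      huk (by omega) (by omega) ?_ hM')
    intro hvz
    rw [← hvz] at hz
    omega
  · obtain rfl := hu.resolve_left huk
    exact .idle 1 hk (GDState.isSplit_afterMerge V hk h.arrived_eq h.duals h.pairs ht
      (h.union_active_first (by omega) (by omega) huv.2.2.1.1) hM')

theorem InPhase.step {V : Variant} {s s' : GDState m} (h : s.InPhase)
    (hs : (tightInstance V m).GDStep s s') : s'.InPhase := by
  cases hs with
  | arrive u hu ht =>
    cases h with
    | idle k hk h =>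
      rw [h.arrived_eq] at hu
      have hu2 : u.val / 2 = k := by omega
      -- The idle phase records no time; the arrival condition supplies it.
      refine .arriving k (by omega) (h.afterArrival hu le_rfl) ?_
      rw [← hu2]; exact ht.symm
    | arriving k hk h ht =>
      rw [h.arrived_eq] at hu
      exact .waiting k 0 hk (h.afterArrival hu (by omega)) (pairDelay_pos (by omega) k).le
        (by rw [add_zero]; exact ht)
    -- Impossible: the next pair is released strictly after the current delay ends.
    | waiting k r hk h hr htime =>
      rw [h.arrived_eq] at hu
      have h1 : s.time = pairTime m (k + 1) := by
        have : u.val / 2 = k + 1 := by omega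
        rw [← ht, ← this]; rfl
      have h2 := pairDelay_add_pairDelay_succ m k
      have h3 := pairDelay_pos (m := m) (by omega) (k + 1)
      linarith
    | merging k x z h =>
      rw [h.arrived_eq] at hu
      have h1 : s.time = pairTime m (k + 1) := by
        have : u.val / 2 = k + 1 := by omega
        rw [← ht, ← this]; rfl
      have h2 := pairDelay_add_pairDelay_succ m k
      have h3 := pairDelay_pos (m := m) (by omega) (k + 1)
      have h4 := h.time_eq
      linarith
  | merge u v M' huv hM =>
    cases h with
    | idle k hk h => exact absurd huv (h.not_tightCrossing_rest V _ u v)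
    | arriving k hk h ht =>
      exact absurd huv (h.not_tightCrossing V hk (by omega) h.duals (pairDelay_pos (by omega) k) u v)
    | waiting k r hk h hr ht =>
      rcases lt_trichotomy u.val v.val with hlt | heq | hlt
      · exact h.inPhase_afterMerge V hk hr ht hlt huv hM
      · exact absurd (Fin.ext heq) huv.2.2.1.1
      · have := h.inPhase_afterMerge (M' := M') V hk hr ht hlt huv.symm
          (by rw [union_comm]; exact hM)
        rwa [afterMerge_comm] at this
    | merging k x z h =>
      have hk : k < m := by have := h.x_pair; omega
      exact .idle (k + 1) hk (h.isSplit_afterMerge V huv hM)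
  | elapse δ hδ harr htight =>
    cases h with
    | idle k hk h => exact .idle k hk ((h.afterElapse δ).rest 0)
    -- Impossible: the second request of the pair is due at this very moment.
    | arriving k hk h ht =>
      exfalso
      have h1 := harr ⟨2 * k + 1, by omega⟩ (by simp [HasArrived, h.arrived_eq])
      have h2 : (tightInstance V m).atime ⟨2 * k + 1, by omega⟩ = pairTime m k := by
        have : (2 * k + 1) / 2 = k := by omega
        simp [tightInstance, this]
      linarith
    | waiting k r hk h hr ht =>
      refine .waiting k (r + δ) hk (h.afterElapse δ) ?_ ?_
      -- Overshooting the delay would pass the moment `pairDelay m k - r`, at which a crossing edge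
      -- is tight.
      · by_contra hlt
        have hy := h.grownY_duals (pairDelay m k - r)
        rw [add_sub_cancel] at hy
        obtain ⟨u, v, huv⟩ := h.exists_tightCrossing V hk hy
        exact htight (pairDelay m k - r) (by linarith) (by linarith) u v huv
      · show s.time + δ = _
        rw [ht, add_assoc]
    | merging k x z h =>
      exfalso
      -- The no-event condition already fails at the start of the period, with growth 0.
      have hy : s.grownY 0 = s.y := by
        funext S
        simp [grownY]
      obtain ⟨u, hu⟩ := h.tightCrossing V h.duals
      refine htight 0 le_rfl hδ u z ?_
      rwa [hy]

theorem inPhase_of_reachable {V : Variant} {s : GDState m}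
    (h : Relation.ReflTransGen (tightInstance V m).GDStep (initial m) s) : s.InPhase := by
  induction h with
  | refl => exact .idle 0 (Nat.zero_le _) (initial_isSplit m)
  | tail _ hs ih => exact ih.step hs

end GDState

/-! ### Properties of every output -/

theorem tightInstance_pairsMatched_of_GDOutput {V : Variant} {M : List (MatchEdge m)}
    (h : (tightInstance V m).GDOutput M) : PairsMatched m m M := by
  obtain ⟨s, hs, -, hcov, rfl⟩ := h
  -- A complete matching covers request `2 * k`, so only the idle phase with `k = m` is possible.
  have key : ∀ k, k < m → ¬ PairsMatched m k s.matching := by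
    intro k hk hM
    have := (hM.mem_iff ⟨2 * k, by omega⟩).mp (hcov _)
    simp at this
  cases GDState.inPhase_of_reachable hs with
  | idle k hk h =>
    rcases hk.lt_or_eq with hk | rfl
    · exact absurd h.pairs (key k hk)
    · exact h.pairs
  | arriving k hk h => exact absurd h.pairs (key k hk)
  | waiting k r hk h => exact absurd h.pairs (key k hk)
  | merging k x z h => exact absurd h.pairs (key k (by have := h.x_pair; omega))

theorem PairsMatched.isFeasible {M : List (MatchEdge m)} (V : Variant) (h : PairsMatched m m M) :
    (tightInstance V m).IsFeasible M := by
  have key : ∀ k : ℕ, pairTime m k ≤ 1 + 2 * (k : ℝ) / m := by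
    intro k
    rw [← pairTime_add_pairDelay]
    have : 0 ≤ pairDelay m k := by unfold pairDelay; split_ifs <;> positivity
    linarith
  refine ⟨h.nodup, fun u => (h.mem_iff u).mpr u.2, fun e he =>
    tightInstance_isEdge_pair V (h.ne e he) (h.same_pair e he), fun e he => ?_, fun e he => ?_⟩
  · rw [h.time_eq e he]; exact key _
  · rw [h.time_eq e he, h.same_pair e he]; exact key _

theorem PairsMatched.connectionCost_eq {M : List (MatchEdge m)} (V : Variant)
    (h : PairsMatched m m M) : (tightInstance V m).connectionCost M = 2 * m := by
  have hlen : M.length = m := by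
    have h1 : (endpoints M).length = 2 * m := by
      have h2 : (endpoints M).toFinset = univ :=
        eq_univ_iff_forall.mpr fun u => List.mem_toFinset.mpr ((h.mem_iff u).mpr u.2)
      rw [← List.toFinset_card_of_nodup h.nodup, h2, card_univ, Fintype.card_fin]
    rw [endpoints_length] at h1
    omega
  have : M.map (fun e => dist ((tightInstance V m).pos e.fst) ((tightInstance V m).pos e.snd))
      = M.map (fun _ => (2 : ℝ)) :=
    List.map_congr_left fun e he => tightInstance_dist_pair V (h.ne e he) (h.same_pair e he)
  rw [Instance.connectionCost, this, List.map_const', List.sum_replicate, hlen, nsmul_eq_mul,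
    mul_comm]

/-- Greedy Dual can process the next pair of requests. -/
theorem exists_run_pair (V : Variant) {s : GDState m} {k : ℕ} (hk : k < m)
    (h : s.IsSplit k (2 * k) 0) (ht : s.time = pairTime m k) :
    ∃ s', Relation.ReflTransGen (tightInstance V m).GDStep s s' ∧
      s'.IsSplit (k + 1) (2 * (k + 1)) 0 ∧ s'.time = pairTime m k + pairDelay m k := by
  have hpos := pairDelay_pos (m := m) (by omega) k
  let x : Fin (2 * m) := ⟨2 * k, by omega⟩
  let z : Fin (2 * m) := ⟨2 * k + 1, by omega⟩
  have hxv : x.val = 2 * k := rfl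
  have hzv : z.val = 2 * k + 1 := rfl
  have hx : x.val / 2 = k := by omega
  have hz : z.val / 2 = k := by omega
  have hne : x ≠ z := fun h => by rw [h] at hxv; omega
  have hxt : (tightInstance V m).atime x = pairTime m k := congrArg (pairTime m) hx
  have hzt : (tightInstance V m).atime z = pairTime m k := congrArg (pairTime m) hz
  have h1 := h.afterArrival hxv le_rfl
  have h2 := h1.afterArrival hzv (by omega)
  let s₂ := (s.afterArrival x).afterArrival z
  have ht2 : s₂.time = pairTime m k := ht
  have h3 : (s₂.afterElapse (pairDelay m k)).IsSplit k (2 * k + 2) (pairDelay m k) := by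
    simpa using h2.afterElapse (pairDelay m k)
  let s₃ := s₂.afterElapse (pairDelay m k)
  have ht3 : s₃.time = pairTime m k + pairDelay m k := by rw [← ht2]; rfl
  have hrun : Relation.ReflTransGen (tightInstance V m).GDStep s s₃ := by
    refine ((Relation.ReflTransGen.single (Instance.GDStep.arrive s x ?_ ?_)).tail
      (Instance.GDStep.arrive _ z ?_ ?_)).tail (Instance.GDStep.elapse s₂ _ hpos ?_ ?_)
    · rw [hxv, h.arrived_eq]
    · rw [hxt, ht]
    · exact hzv.trans h1.arrived_eq.symm
    · rw [hzt]; exact ht.symm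
    · intro u hu
      rw [GDState.HasArrived, h2.arrived_eq] at hu
      rw [ht2]
      have h4 : pairTime m (k + 1) ≤ (tightInstance V m).atime u := pairTime_mono m (by omega)
      have h5 := pairDelay_add_pairDelay_succ m k
      have h6 := pairDelay_pos (m := m) (by omega) (k + 1)
      linarith
    · intro r _ hr u v
      have := h2.grownY_duals r
      rw [zero_add] at this
      exact h2.not_tightCrossing V hk le_rfl this hr u v
  -- The first pair needs one merge. Later pairs need two: `x` joins through its predecessor without
  -- any matching, then `z` joins and the pair is matched.
  rcases Nat.eq_zero_or_pos k with rfl | hk0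
  · have hun := h3.union_active_first (u := x) (v := z) (by omega) (by omega) hne
    obtain ⟨M', hM'⟩ := exists_matchFree_pair V s₃.time hx hz hne
      (S := s₃.active x ∪ s₃.active z) (by rw [hun]; exact h3.pairs.freeRequests_eq hx hz hne rfl)
    refine ⟨_, hrun.tail (Instance.GDStep.merge s₃ x z M' ⟨?_, ?_,
      tightInstance_isEdge_pair V hne (by omega), ?_, h3.duals.isTight_first V hne (by omega)
        (by omega) (by omega) (by omega)⟩ hM'),
      GDState.isSplit_afterMerge V hk h3.arrived_eq h3.duals h3.pairs ht3 hun hM', ht3⟩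
    · rw [GDState.HasArrived, h3.arrived_eq]; omega
    · rw [GDState.HasArrived, h3.arrived_eq]; omega
    · rw [h3.active_eq x (by omega), h3.active_eq z (by omega), if_neg (by omega),
        if_neg (by omega)]
      simpa using hne
  · let u : Fin (2 * m) := ⟨2 * k - 2, by omega⟩
    have huv : u.val = 2 * k - 2 := rfl
    have hun := h3.union_active (u := u) (v := x) (by omega) hx
    have hM : (tightInstance V m).MatchFree s₃.time (s₃.active u ∪ s₃.active x) s₃.matching
        s₃.matching := .finish _ (by rw [hun]; exact h3.no_edge_insert V)
    have h4 := h3.isMerging_afterMerge V ht3 (u := u) (by omega) hx hz hne hM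
    have hrun4 := hrun.tail (Instance.GDStep.merge s₃ u x _ ⟨by
        rw [GDState.HasArrived, h3.arrived_eq]; omega, by
        rw [GDState.HasArrived, h3.arrived_eq]; omega,
        tightInstance_isEdge_succ V (by omega), by
        rw [h3.active_eq u (by omega), h3.active_eq x (by omega), if_pos (by omega),
          if_neg (by omega)]
        intro heq
        have : x ∈ firstRequests m (2 * k) := by rw [heq]; simp
        rw [mem_firstRequests] at this
        omega,
        h3.duals.isTight_succ V (by omega) (by omega) hx⟩ hM)
    let s₄ := s₃.afterMerge u x s₃.matching
    obtain ⟨w, hw⟩ := h4.tightCrossing V h4.duals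
    have hwz : w ≠ z := hw.2.2.1.1
    have hun4 : s₄.active w ∪ s₄.active z = firstRequests m (2 * k + 2) := by
      have hw1 : w.val < 2 * k + 2 := by
        have := hw.1
        rwa [GDState.HasArrived, h4.arrived_eq] at this
      rw [h4.active_x w hw1 hwz, h4.active_z, firstRequests_add_two hx hz hne, union_comm]
      rfl
    obtain ⟨M', hM'⟩ := exists_matchFree_pair V s₄.time hx hz hne
      (S := s₄.active w ∪ s₄.active z) (by rw [hun4]; exact h4.pairs.freeRequests_eq hx hz hne rfl)
    exact ⟨_, hrun4.tail (Instance.GDStep.merge s₄ w z M' hw hM'),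
      h4.isSplit_afterMerge V hw hM', ht3⟩

theorem exists_run_pairs (V : Variant) {k : ℕ} (hk : k < m) :
    ∃ s, Relation.ReflTransGen (tightInstance V m).GDStep (GDState.initial m) s ∧
      s.IsSplit (k + 1) (2 * (k + 1)) 0 ∧ s.time = pairTime m k + pairDelay m k := by
  induction k with
  | zero =>
    exact exists_run_pair V hk (GDState.initial_isSplit m) (by simp [GDState.initial, pairTime_zero])
  | succ k ih =>
    obtain ⟨s, hs, h, ht⟩ := ih (by omega)
    have hpos := pairDelay_pos (m := m) (by omega) (k + 1)
    -- The idle period before a later pair is as long as the delay of that pair, namely `1 / m`.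
    have hnext : s.time + pairDelay m (k + 1) = pairTime m (k + 1) := by
      have := pairDelay_add_pairDelay_succ m k
      linarith
    obtain ⟨s', hs', h', ht'⟩ := exists_run_pair V hk
      ((h.afterElapse (pairDelay m (k + 1))).rest 0) hnext
    refine ⟨s', (hs.tail (Instance.GDStep.elapse s _ hpos ?_ ?_)).trans hs', h', ht'⟩
    · intro u hu
      rw [GDState.HasArrived, h.arrived_eq] at hu
      rw [hnext]
      exact pairTime_mono m (by omega)
    · intro r _ _ u v
      exact h.not_tightCrossing_rest V _ u v

theorem tightInstance_exists_GDOutput (V : Variant) (hm : 0 < m) :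
    ∃ M, (tightInstance V m).GDOutput M := by
  obtain ⟨s, hs, h, -⟩ := exists_run_pairs V (m := m) (k := m - 1) (by omega)
  refine ⟨s.matching, s, hs, fun u => ?_, fun u => ?_, rfl⟩
  · rw [GDState.HasArrived, h.arrived_eq]; omega
  · rw [h.pairs.mem_iff]; omega

end GreedyDualRuns

theorem mainTheorem2 :
    ∃ c : ℝ, 0 < c ∧ ∀ (V : Variant) (m : ℕ), 0 < m →
      (tightInstance V m).IsOf V ∧
      0 < (tightInstance V m).opt ∧
      (∃ M, (tightInstance V m).GDOutput M) ∧
      (∀ M, (tightInstance V m).GDOutput M →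
        (tightInstance V m).IsFeasible M ∧
        (∀ e ∈ M, e.fst.val / 2 = e.snd.val / 2 ∧
          dist ((tightInstance V m).pos e.fst) ((tightInstance V m).pos e.snd) = 2 ∧
          e.time = 1 + 2 * ((e.fst.val / 2 : ℕ) : ℝ) / m) ∧
        (tightInstance V m).connectionCost M = 2 * m ∧
        c * m * (tightInstance V m).opt ≤ (tightInstance V m).cost M) ∧
      (Even m → ∃ M, (tightInstance V m).IsFeasible M ∧
        (∀ e ∈ M, (tightInstance V m).pos e.fst = (tightInstance V m).pos e.snd ∧
          Even (e.fst.val / 2) ∧ e.snd.val = e.fst.val + 2 ∧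
          e.time = (tightInstance V m).atime e.snd) ∧
        (tightInstance V m).cost M = 2 * (1 + ((m : ℝ) - 1) / m) ∧
        (tightInstance V m).cost M < 4) := by
  -- The constant is the ratio of the connection cost `2 * m` to `m` times the upper bound 6 on the
  -- optimum.
  refine ⟨1 / 3, by norm_num, fun V m hm => ⟨tightInstance_isOf V m, tightInstance_opt_pos V hm,
    tightInstance_exists_GDOutput V hm, fun M hM => ?_, exists_local_feasible V hm⟩⟩
  have h := tightInstance_pairsMatched_of_GDOutput hM
  have hf := h.isFeasible V
  have hc := h.connectionCost_eq V
  refine ⟨hf, fun e he => ⟨h.same_pair e he, tightInstance_dist_pair V (h.ne e he)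
    (h.same_pair e he), h.time_eq e he⟩, hc, ?_⟩
  calc 1 / 3 * (m : ℝ) * (tightInstance V m).opt ≤ 1 / 3 * (m : ℝ) * 6 := by
        gcongr
        exact tightInstance_opt_le V hm
    _ = (tightInstance V m).connectionCost M := by rw [hc]; ring
    _ ≤ (tightInstance V m).cost M := hf.connectionCost_le_cost
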